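/- Let $\Gamma$ be a simple graph (no loops or multiple edges) with vertex set $V(\Gamma)$ and edge set $E(\Gamma)$. The right-angled Artin group on $\Gamma$ is $$A(\Gamma)=\langle V(\Gamma)\mid [v,v']=1 \text{ for each } \{v,v'\}\in E(\Gamma)\rangle.$$ The extension graph $\Gamma^e$ is the simple graph whose vertices are the elements of $A(\Gamma)$ that are conjugate in $A(\Gamma)$ to a vertex generator $v\in V(\Gamma)$, two distinct such elements being adjacent if and only if they commute in $A(\Gamma)$. **Theorem.** Let $\Lambda$ and $\Gamma$ be finite simple graphs. If $\Lambda$ is isomorphic to an induced subgraph of $\Gamma^e$, then there is an injective group homomorphism $A(\Lambda)\to A(\Gamma)$. -/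

import Mathlib

open scoped commutatorElement

/-- The right-angled Artin group `A(G)` on a graph `G`: it is generated by the vertices of `G`,
subject to the relations `[v, w] = 1` for all adjacent vertices `v`, `w` of `G`. -/
abbrev RAAG {V : Type*} (G : SimpleGraph V) : Type _ :=
  PresentedGroup {r : FreeGroup V | ∃ v w : V, G.Adj v w ∧ r = ⁅FreeGroup.of v, FreeGroup.of w⁆}

/-- The generator of `A(G)` given by a vertex `v` of `G`. -/
def RAAG.of {V : Type*} (G : SimpleGraph V) (v : V) : RAAG G :=
  PresentedGroup.of v

/-- The vertices of the extension graph of `G`: the elements of `A(G)` that are conjugate in `A(G)`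
to some vertex generator. -/
def extensionVertices {V : Type*} (G : SimpleGraph V) : Set (RAAG G) :=
  {g | ∃ v : V, IsConj (RAAG.of G v) g}

/-- The extension graph of `G`: two distinct conjugates of vertex generators are adjacent
if and only if they commute in `A(G)`. -/
def extensionGraph {V : Type*} (G : SimpleGraph V) : SimpleGraph (extensionVertices G) where
  Adj x y := x ≠ y ∧ Commute (x : RAAG G) (y : RAAG G)
  symm := ⟨fun _ _ h => ⟨h.1.symm, h.2.symm⟩⟩
  loopless := ⟨fun _ h => h.1 rfl⟩

/-! ### Generators, homomorphisms and words -/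

namespace RAAG

variable {V V' : Type*} {G : SimpleGraph V} {G' : SimpleGraph V'} {H : Type*} [Group H]

/-! Conjugates of generators with commutation graph `Λ` need not be free generators of a copy of
`A(Λ)`: in the free group on x, y, the elements x, y, xyx⁻¹ satisfy a relation. Suitable powers of
them do generate such a copy, and they are found by induction on the total length of the conjugating
words.

Fix a vertex v. The elements of `A(G)` whose exponent sum in v is divisible by n form the
right-angled Artin group of n copies of `G` glued along the star of v (`foldHom_injective`). For
large n, after a common conjugation by a power of v and passage to powers, each given conjugate
becomes a conjugate of a generator of that group, by a word in which the letters v have disappeared: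
they only record the copy (`exists_word_of_foldHom`). Powers preserve and reflect commutation and
equality of conjugates (`commute_of_conj_pow_pow`, `eq_of_conj_pow_eq`), because v and its nonzero
powers have the same centralizer (`commute_of_of_pow`). When all words are empty, `Λ` is an induced
subgraph of the current graph.

The facts about v come from embedding `A(G)` in a semidirect product where v acts as a translation
of infinitely many copies of `G`. -/

theorem commute_of_adj {x y : V} (h : G.Adj x y) : Commute (of G x) (of G y) := by
  rw [← commutatorElement_eq_one_iff_commute]
  exact PresentedGroup.one_of_mem (rels := {r : FreeGroup V | ∃ v w : V, G.Adj v w ∧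
    r = ⁅FreeGroup.of v, FreeGroup.of w⁆}) ⟨x, y, h, rfl⟩

/-- The homomorphism out of `A(G)` given by images of the vertices that commute along edges. -/
def lift (f : V → H) (hf : ∀ x y, G.Adj x y → Commute (f x) (f y)) : RAAG G →* H :=
  PresentedGroup.toGroup (f := f) (by
    rintro r ⟨x, y, h, rfl⟩
    rw [map_commutatorElement, FreeGroup.lift_apply_of, FreeGroup.lift_apply_of,
      commutatorElement_eq_one_iff_commute]
    exact hf x y h)

@[simp]
theorem lift_of (f : V → H) (hf : ∀ x y, G.Adj x y → Commute (f x) (f y)) (x : V) :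
    lift f hf (of G x) = f x :=
  PresentedGroup.toGroup.of _

theorem hom_ext {f g : RAAG G →* H} (h : ∀ x, f (of G x) = g (of G x)) : f = g :=
  PresentedGroup.ext h

theorem closure_range_of : Subgroup.closure (Set.range (of G)) = ⊤ :=
  PresentedGroup.closure_range_of _

/-- An induced subgraph gives a subgroup. -/
theorem exists_injective_of_embedding (f : G ↪g G') :
    ∃ φ : RAAG G →* RAAG G', Function.Injective φ := by
  classical
  let φ : RAAG G →* RAAG G' := lift (fun x => of G' (f x))
    fun x y h => commute_of_adj (f.map_rel_iff.2 h)
  -- Sending the vertices outside the image to 1 respects every edge; edges inside the image come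
  -- from `G` because the subgraph is induced.
  let r : V' → RAAG G := fun z => if h : ∃ x, f x = z then of G h.choose else 1
  have hr (x : V) : r (f x) = of G x := by
    have h : ∃ x', f x' = f x := ⟨x, rfl⟩
    simp only [r, dif_pos h]
    rw [f.injective h.choose_spec]
  let ψ : RAAG G' →* RAAG G := lift r fun y z h => by
    by_cases hy : ∃ x, f x = y
    · by_cases hz : ∃ x, f x = z
      · obtain ⟨a, rfl⟩ := hy
        obtain ⟨b, rfl⟩ := hz
        rw [hr, hr]
        exact commute_of_adj (f.map_rel_iff.1 h)
      · simp only [r, dif_neg hz, Commute.one_right]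
    · simp only [r, dif_neg hy, Commute.one_left]
  have h : ψ.comp φ = MonoidHom.id _ := hom_ext fun x => by simp [φ, ψ, hr]
  exact ⟨φ, Function.LeftInverse.injective (g := ψ) fun x => DFunLike.congr_fun h x⟩

/-- If x and y were not adjacent, they could be sent to two non-commuting transpositions and all
other vertices to 1. -/
theorem adj_of_commute {x y : V} (hxy : x ≠ y) (h : Commute (of G x) (of G y)) : G.Adj x y := by
  classical
  by_contra hadj
  let f : V → Equiv.Perm (Fin 3) := fun z =>
    if z = x then Equiv.swap 0 1 else if z = y then Equiv.swap 1 2 else 1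
  have hf : ∀ a b, G.Adj a b → Commute (f a) (f b) := by
    intro a b hab
    by_cases hax : a = x
    · by_cases hby : b = y
      · subst hax hby
        exact absurd hab hadj
      · by_cases hbx : b = x <;> simp [f, hax, hby, hbx]
    · by_cases hay : a = y
      · by_cases hbx : b = x
        · subst hay hbx
          exact absurd hab.symm hadj
        · by_cases hby : b = y <;> simp [f, hay, hby, hbx, hxy.symm]
      · simp [f, hax, hay]
  have h' := h.map (lift f hf)
  simp only [lift_of, f, if_true, if_neg hxy.symm] at h'
  revert h'
  unfold Commute SemiconjBy
  decide

/-- The exponent sum of the generator `v`. -/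
noncomputable def exponent (G : SimpleGraph V) (v : V) : RAAG G →* Multiplicative ℤ :=
  open Classical in
  lift (fun x => if x = v then Multiplicative.ofAdd 1 else 1) fun _ _ _ => Commute.all _ _

theorem exponent_of_self (v : V) : exponent G v (of G v) = Multiplicative.ofAdd 1 := by
  simp [exponent]

theorem exponent_of_ne {v x : V} (h : x ≠ v) : exponent G v (of G x) = 1 := by
  simp [exponent, h]

/-- The element of `A(G)` spelled by a word in the generators and their inverses. -/
def word (G : SimpleGraph V) (l : List (V × Bool)) : RAAG G :=
  (l.map fun p => cond p.2 (of G p.1) (of G p.1)⁻¹).prod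

theorem word_cons (p : V × Bool) (l : List (V × Bool)) :
    word G (p :: l) = cond p.2 (of G p.1) (of G p.1)⁻¹ * word G l := by
  simp [word]

theorem word_surjective : Function.Surjective (word G) := by
  classical
  intro g
  obtain ⟨w, rfl⟩ := PresentedGroup.mk_surjective _ g
  refine ⟨w.toWord, ?_⟩
  have h : PresentedGroup.mk {r : FreeGroup V | ∃ v w : V, G.Adj v w ∧
      r = ⁅FreeGroup.of v, FreeGroup.of w⁆} = FreeGroup.lift (of G) :=
    FreeGroup.ext_hom _ _ fun x => by simp [of, PresentedGroup.of]
  rw [h]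
  conv_rhs => rw [← FreeGroup.mk_toWord (x := w)]
  rw [FreeGroup.lift_mk]
  rfl

end RAAG

/-! ### The cover and its extension by translation -/

namespace RAAG

variable {V : Type*} (G : SimpleGraph V) (v : V) {H : Type*} [Group H]

/-- Membership in the closed star of `v`. -/
def InStar (x : V) : Prop := x = v ∨ G.Adj v x

/-- Infinitely many copies of `G`, in which the links of `v` are to be thought of as identified. -/
def cover : SimpleGraph (V × ℤ) where
  Adj p q := G.Adj p.1 q.1 ∧ (p.2 = q.2 ∨ G.Adj v p.1 ∨ G.Adj v q.1)
  symm := ⟨fun _ _ h => ⟨h.1.symm, h.2.elim (fun h => .inl h.symm) fun h => .inr h.symm⟩⟩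
  loopless := ⟨fun _ h => G.irrefl h.1⟩

open Classical in
/-- Translation of the copies of `G` outside the star of `v`. -/
noncomputable def shift (k : ℤ) (p : V × ℤ) : V × ℤ :=
  (p.1, if InStar G v p.1 then p.2 else p.2 + k)

variable {G v}

theorem shift_of_inStar {x : V} (h : InStar G v x) (k i : ℤ) : shift G v k (x, i) = (x, i) := by
  simp [shift, h]

theorem shift_of_not_inStar {x : V} (h : ¬InStar G v x) (k i : ℤ) :
    shift G v k (x, i) = (x, i + k) := by
  simp [shift, h]

theorem shift_shift (k l : ℤ) (p : V × ℤ) : shift G v k (shift G v l p) = shift G v (k + l) p := by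
  obtain ⟨x, i⟩ := p
  by_cases h : InStar G v x
  · simp only [shift_of_inStar h]
  · simp only [shift_of_not_inStar h, Prod.mk.injEq, true_and]
    ring

theorem shift_zero (p : V × ℤ) : shift G v 0 p = p := by
  obtain ⟨x, i⟩ := p
  by_cases h : InStar G v x
  · simp only [shift_of_inStar h]
  · simp [shift_of_not_inStar h]

/-- If neither end lies in the link of v, then neither lies over v, since its neighbour would then
lie in the link. -/
theorem cover_adj_cases {p q : V × ℤ} (h : (cover G v).Adj p q) :
    G.Adj v p.1 ∨ G.Adj v q.1 ∨ p.2 = q.2 ∧ ¬InStar G v p.1 ∧ ¬InStar G v q.1 := by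
  by_cases hp : G.Adj v p.1
  · exact .inl hp
  by_cases hq : G.Adj v q.1
  · exact .inr (.inl hq)
  refine .inr (.inr ⟨by simpa [hp, hq] using h.2, ?_, ?_⟩)
  · rintro (hpv | hpv)
    · exact hq (hpv ▸ h.1)
    · exact hp hpv
  · rintro (hqv | hqv)
    · exact hp (hqv ▸ h.1.symm)
    · exact hq hqv

theorem shift_adj (k : ℤ) {p q : V × ℤ} (h : (cover G v).Adj p q) :
    (cover G v).Adj (shift G v k p) (shift G v k q) := by
  refine ⟨h.1, ?_⟩
  obtain hp | hq | ⟨hpq, hp, hq⟩ := cover_adj_cases h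
  · exact .inr (.inl hp)
  · exact .inr (.inr hq)
  · left
    simp [shift, hp, hq, hpq]

variable (G v)

/-- The endomorphism of the group of the cover induced by a translation. -/
noncomputable def shiftHom (k : ℤ) : RAAG (cover G v) →* RAAG (cover G v) :=
  lift (fun p => of _ (shift G v k p)) fun _ _ h => commute_of_adj (shift_adj k h)

variable {G v}

@[simp]
theorem shiftHom_of (k : ℤ) (p : V × ℤ) :
    shiftHom G v k (of _ p) = of (cover G v) (shift G v k p) :=
  lift_of _ _ _

theorem shiftHom_shiftHom (k l : ℤ) (g : RAAG (cover G v)) :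
    shiftHom G v k (shiftHom G v l g) = shiftHom G v (k + l) g :=
  DFunLike.congr_fun (f := (shiftHom G v k).comp (shiftHom G v l))
    (hom_ext fun p => by simp [shift_shift]) g

theorem shiftHom_zero (g : RAAG (cover G v)) : shiftHom G v 0 g = g :=
  DFunLike.congr_fun (g := MonoidHom.id _) (hom_ext fun p => by simp [shift_zero]) g

variable (G v)

/-- The action of the integers on the group of the cover by multiples of the translation by `n`. -/
noncomputable def shiftAut (n : ℤ) : Multiplicative ℤ →* MulAut (RAAG (cover G v)) where
  toFun k :=
    { shiftHom G v (n * k.toAdd) with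
      invFun := shiftHom G v (-(n * k.toAdd))
      left_inv := fun g => by
        change shiftHom G v _ (shiftHom G v _ g) = g
        rw [shiftHom_shiftHom, neg_add_cancel, shiftHom_zero]
      right_inv := fun g => by
        change shiftHom G v _ (shiftHom G v _ g) = g
        rw [shiftHom_shiftHom, add_neg_cancel, shiftHom_zero] }
  map_one' := by
    ext g
    change shiftHom G v (n * 0) g = g
    rw [mul_zero, shiftHom_zero]
  map_mul' k l := by
    ext g
    change shiftHom G v (n * (k.toAdd + l.toAdd)) g = shiftHom G v _ (shiftHom G v _ g)
    rw [shiftHom_shiftHom, mul_add]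

variable {G v}

theorem shiftAut_apply (n : ℤ) (k : Multiplicative ℤ) (g : RAAG (cover G v)) :
    shiftAut G v n k g = shiftHom G v (n * k.toAdd) g :=
  rfl

variable (G v)

/-- The extension of the group of the cover by the translation by `n`. -/
abbrev CoverExt (n : ℤ) : Type _ := RAAG (cover G v) ⋊[shiftAut G v n] Multiplicative ℤ

variable {G v}

/-- Homomorphisms from `CoverExt` that send the translation to `c` and the vertices of `n`
consecutive copies to given elements. -/
noncomputable def CoverExt.lift (n : ℤ) (hn : 0 < n) (c : H) (a : V × ℤ → H)
    (hc : ∀ x i, InStar G v x → Commute c (a (x, i)))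
    (ha : ∀ p q, (cover G v).Adj p q → Commute (a p) (a q))
    (hp : ∀ x i, a (x, i + n) = a (x, i)) : CoverExt G v n →* H :=
  have conj_of_inStar : ∀ x i (k : ℤ), InStar G v x → c ^ k * a (x, i) * (c ^ k)⁻¹ = a (x, i) :=
    fun x i k h => by rw [((hc x i h).zpow_left k).eq, mul_inv_cancel_right]
  have conj_far : ∀ x y i (k : ℤ), G.Adj v x → G.Adj x y → ∀ j,
      Commute (a (x, i)) (c ^ k * a (y, j) * (c ^ k)⁻¹) := fun x y i k hx hxy j => by
    have h : Commute (a (x, i)) (c ^ k) := ((hc x i (.inr hx)).zpow_left k).symm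
    exact (h.mul_right (ha (x, i) (y, j) ⟨hxy, .inr (.inl hx)⟩)).mul_right h.inv_right
  SemidirectProduct.lift
    -- Copy i is the translate of copy i mod n by n · ⌊i / n⌋, and `c` plays the translation by n.
    (RAAG.lift (fun p => c ^ (p.2 / n) * a p * (c ^ (p.2 / n))⁻¹) fun p q h => by
      obtain ⟨x, i⟩ := p
      obtain ⟨y, j⟩ := q
      obtain hx | hy | ⟨hpq, -, -⟩ := cover_adj_cases h
      · rw [conj_of_inStar x i _ (.inr hx)]
        exact conj_far _ _ _ _ hx h.1 _
      · rw [conj_of_inStar y j _ (.inr hy)]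
        exact (conj_far _ _ _ _ hy h.1.symm _).symm
      · obtain rfl : i = j := hpq
        exact (Commute.conj_iff _).2 (ha _ _ h))
    (zpowersHom H c) fun k => hom_ext fun p => by
      obtain ⟨x, i⟩ := p
      simp only [MonoidHom.comp_apply, MulEquiv.coe_toMonoidHom, shiftAut_apply, shiftHom_of,
        lift_of, MulAut.conj_apply, zpowersHom_apply]
      have hper : ∀ k : ℤ, a (x, i + n * k) = a (x, i) := by
        intro k
        induction k with
        | zero => simp
        | succ k ih => rw [← ih, mul_add, mul_one, ← add_assoc, hp]
        | pred k ih => rw [← ih, mul_sub, mul_one, ← hp x (i + (n * -k - n))]; congr 2; ring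
      by_cases hx : InStar G v x
      · rw [shift_of_inStar hx, conj_of_inStar x i _ hx, conj_of_inStar x i _ hx]
      · rw [shift_of_not_inStar hx, hper, Int.add_mul_ediv_left _ _ hn.ne', zpow_add,
          ((Commute.refl c).zpow_zpow (i / n) k.toAdd).eq]
        group

section

variable (n : ℤ) (hn : 0 < n) (c : H) (a : V × ℤ → H)
    (hc : ∀ x i, InStar G v x → Commute c (a (x, i)))
    (ha : ∀ p q, (cover G v).Adj p q → Commute (a p) (a q))
    (hp : ∀ x i, a (x, i + n) = a (x, i))

theorem CoverExt.lift_inl_of (p : V × ℤ) :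
    CoverExt.lift n hn c a hc ha hp (.inl (of _ p)) =
      c ^ (p.2 / n) * a p * (c ^ (p.2 / n))⁻¹ := by
  simp [CoverExt.lift]

theorem CoverExt.lift_inr (k : Multiplicative ℤ) :
    CoverExt.lift n hn c a hc ha hp (.inr k) = c ^ k.toAdd := by
  simp [CoverExt.lift]

end

theorem inr_mul_inl_of_mul_inv (n : ℤ) (k : Multiplicative ℤ) (p : V × ℤ) :
    (.inr k * .inl (of _ p) * (.inr k)⁻¹ : CoverExt G v n) =
      .inl (of _ (shift G v (n * k.toAdd) p)) := by
  rw [← shiftHom_of, ← shiftAut_apply, SemidirectProduct.inl_aut, map_inv]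

variable (G v)

open Classical in
/-- The embedding of `A(G)` sending `v` to the translation and other vertices into one copy. -/
noncomputable def toCoverExt : RAAG G →* CoverExt G v 1 :=
  lift (fun x => if x = v then .inr (.ofAdd 1) else .inl (of _ (x, 0))) fun x y h => by
    have key : ∀ z, G.Adj v z → Commute (.inr (.ofAdd 1)) (.inl (of _ (z, 0)) : CoverExt G v 1) :=
      fun z hz => by
        have := inr_mul_inl_of_mul_inv (G := G) (v := v) 1 (.ofAdd 1) (z, 0)
        rw [shift_of_inStar (.inr hz)] at this
        exact mul_inv_eq_iff_eq_mul.1 this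
    by_cases hx : x = v
    · subst hx
      simpa [h.ne'] using key y h
    · by_cases hy : y = v
      · subst hy
        simpa [hx] using (key x h.symm).symm
      · simp only [hx, hy, if_false]
        exact (commute_of_adj (G := cover G v) (x := (x, 0)) (y := (y, 0)) ⟨h, .inl rfl⟩).map _

variable {G v}

theorem toCoverExt_of_self : toCoverExt G v (of G v) = .inr (.ofAdd 1) := by
  simp [toCoverExt]

theorem toCoverExt_of_ne {x : V} (h : x ≠ v) : toCoverExt G v (of G x) = .inl (of _ (x, 0)) := by
  simp [toCoverExt, h]

/-- A left inverse forgets the copy and sends the translation back to v. The redundant copies of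
star vertices are therefore harmless. -/
theorem toCoverExt_injective : Function.Injective (toCoverExt G v) := by
  let ψ : CoverExt G v 1 →* RAAG G := CoverExt.lift 1 one_pos (of G v) (fun p => of G p.1)
    (fun x _ hx => by
      obtain rfl | hx := hx
      · exact .refl _
      · exact commute_of_adj hx)
    (fun p q h => commute_of_adj h.1) fun _ _ => rfl
  have h : ψ.comp (toCoverExt G v) = MonoidHom.id _ := hom_ext fun x => by
    by_cases hx : x = v
    · subst hx
      simp [ψ, toCoverExt_of_self, CoverExt.lift_inr]
    · simp [ψ, toCoverExt_of_ne hx, CoverExt.lift_inl_of]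
  exact Function.LeftInverse.injective (g := ψ) fun x => DFunLike.congr_fun h x

/-! ### Fixed points of the translation and centralizers -/

open Classical in
/-- The retraction of the group of the cover killing all vertices outside the star of `v` in the
copies of index larger than `m` in absolute value. -/
noncomputable def truncate (G : SimpleGraph V) (v : V) (m : ℕ) :
    RAAG (cover G v) →* RAAG (cover G v) :=
  lift (fun p => if InStar G v p.1 ∨ |p.2| ≤ m then of _ p else 1) fun p q h => by
    split_ifs <;> simp [commute_of_adj h]

theorem truncate_of_inStar {x : V} (h : InStar G v x) (m : ℕ) (i : ℤ) :
    truncate G v m (of _ (x, i)) = of _ (x, i) := by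
  simp [truncate, h]

theorem exists_truncate_eq (g : RAAG (cover G v)) :
    ∃ m₀ : ℕ, ∀ m ≥ m₀, truncate G v m g = g := by
  have hg : g ∈ Subgroup.closure (Set.range (of (cover G v))) := by
    rw [closure_range_of]
    trivial
  induction hg using Subgroup.closure_induction with
  | mem x hx =>
    obtain ⟨p, rfl⟩ := hx
    refine ⟨p.2.natAbs, fun m hm => ?_⟩
    have : |p.2| ≤ m := by
      rw [Int.abs_eq_natAbs]
      exact_mod_cast hm
    simp [truncate, this]
  | one => exact ⟨0, fun m _ => map_one _⟩
  | mul x y _ _ hx hy =>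
    obtain ⟨m, hm⟩ := hx
    obtain ⟨m', hm'⟩ := hy
    refine ⟨max m m', fun k hk => ?_⟩
    rw [map_mul, hm _ (le_trans (le_max_left _ _) hk), hm' _ (le_trans (le_max_right _ _) hk)]
  | inv x _ hx =>
    obtain ⟨m, hm⟩ := hx
    exact ⟨m, fun k hk => by rw [map_inv, hm _ hk]⟩

/-- Periodic points of the translation are fixed points. -/
theorem shiftHom_eq_of_shiftHom_eq {a : ℤ} (ha : 0 < a) {g : RAAG (cover G v)}
    (hg : shiftHom G v a g = g) (l : ℤ) : shiftHom G v l g = g := by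
  obtain ⟨m, hm⟩ := exists_truncate_eq g
  have hm := hm m le_rfl
  have hmul : ∀ k : ℕ, shiftHom G v (a * k) g = g := by
    intro k
    induction k with
    | zero => simp [shiftHom_zero]
    | succ k ih => rw [Nat.cast_succ, mul_add, mul_one, ← shiftHom_shiftHom, hg, ih]
  -- A shift by at least 2m + 1 pushes every index in [-m, m] above m, so `τ` kills all generators
  -- outside the star, while it fixes `g`. Its image consists of translation-invariant elements.
  let τ := (truncate G v m).comp ((shiftHom G v (a * (2 * m + 1 : ℕ))).comp (truncate G v m))
  have hτ : (shiftHom G v l).comp τ = τ := hom_ext fun p => by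
    obtain ⟨x, i⟩ := p
    by_cases hx : InStar G v x
    · simp [τ, truncate_of_inStar hx, shift_of_inStar hx]
    · by_cases hi : |i| ≤ m
      · have h1 : truncate G v m (of _ (x, i)) = of _ (x, i) := by simp [truncate, hi]
        have h2 : ¬|i + a * (2 * m + 1 : ℕ)| ≤ m := by
          rw [abs_le] at hi ⊢
          rintro ⟨-, h⟩
          push_cast at h
          nlinarith
        have h3 : truncate G v m (of _ (x, i + a * (2 * m + 1 : ℕ))) = 1 := by
          simp only [truncate, lift_of, hx, false_or, if_neg h2]
        simp only [τ, MonoidHom.comp_apply, h1, shiftHom_of, shift_of_not_inStar hx, h3, map_one]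
      · have h1 : truncate G v m (of _ (x, i)) = 1 := by simp [truncate, hi, hx]
        simp only [τ, MonoidHom.comp_apply, h1, map_one]
  have hτg : τ g = g := by simp only [τ, MonoidHom.comp_apply, hm, hmul]
  have := DFunLike.congr_fun hτ g
  rwa [MonoidHom.comp_apply, hτg] at this

/-- An element commuting with a power of a generator commutes with the generator. -/
theorem commute_of_of_pow {n : ℕ} (hn : n ≠ 0) {g : RAAG G} (h : Commute (of G v ^ n) g) :
    Commute (of G v) g := by
  have h' := h.map (toCoverExt G v)
  rw [map_pow, toCoverExt_of_self, ← map_pow] at h'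
  suffices Commute (toCoverExt G v (of G v)) (toCoverExt G v g) by
    exact toCoverExt_injective (by simpa only [map_mul] using this.eq)
  rw [toCoverExt_of_self]
  generalize toCoverExt G v g = p at h'
  -- Commuting with the translation by n means that the left component is invariant under it.
  have h1 := congrArg SemidirectProduct.left h'.eq
  simp only [SemidirectProduct.mul_left, SemidirectProduct.left_inr, SemidirectProduct.right_inr,
    one_mul, map_one, mul_one, shiftAut_apply] at h1
  have h2 := shiftHom_eq_of_shiftHom_eq (by simpa using Nat.pos_of_ne_zero hn) h1
  ext
  · simp only [SemidirectProduct.mul_left, SemidirectProduct.left_inr, SemidirectProduct.right_inr,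
      one_mul, map_one, mul_one, shiftAut_apply, h2]
  · simp [mul_comm]

end RAAG

/-! ### Multiple doubles as subgroups -/

namespace RAAG

variable {V : Type*} (G : SimpleGraph V) (v : V)

/-- The vertices of the first `n` copies of `G` in the cover, with identified stars of `v`. -/
def window (n : ℕ) : Set (V × ℤ) :=
  {p | 0 ≤ p.2 ∧ p.2 < n ∧ (InStar G v p.1 → p.2 = 0)}

variable {G} in
open Classical in
/-- The vertex of the window in the orbit of `(x, i)` under translation by `n`. -/
noncomputable def windowVertex {n : ℕ} (hn : 0 < n) (p : V × ℤ) : window G v n :=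
  ⟨(p.1, if InStar G v p.1 then 0 else p.2 % n), by
    have hn' : (n : ℤ) ≠ 0 := by exact_mod_cast hn.ne'
    have hn'' : (0 : ℤ) < n := by exact_mod_cast hn
    refine ⟨?_, ?_, fun h => if_pos h⟩ <;> dsimp only <;> split_ifs
    · exact le_rfl
    · exact Int.emod_nonneg _ hn'
    · exact hn''
    · exact Int.emod_lt_of_pos _ hn''⟩

/-- The graph of `n` copies of `G` glued along the star of `v`. -/
abbrev multiDouble (n : ℕ) : SimpleGraph (window G v n) := (cover G v).induce (window G v n)

variable {G v}

theorem windowVertex_val {n : ℕ} (hn : 0 < n) (p : window G v n) : windowVertex v hn p.1 = p := by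
  obtain ⟨⟨x, i⟩, h0, h1, h2⟩ := p
  refine Subtype.ext (Prod.ext rfl ?_)
  by_cases hx : InStar G v x
  · simp only [windowVertex, if_pos hx]
    exact (h2 hx).symm
  · simp only [windowVertex, if_neg hx]
    exact Int.emod_eq_of_lt h0 h1

theorem windowVertex_adj {n : ℕ} (hn : 0 < n) {p q : V × ℤ} (h : (cover G v).Adj p q) :
    (multiDouble G v n).Adj (windowVertex v hn p) (windowVertex v hn q) := by
  refine ⟨h.1, ?_⟩
  obtain hp | hq | ⟨hpq, hp, hq⟩ := cover_adj_cases h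
  · exact .inr (.inl hp)
  · exact .inr (.inr hq)
  · left
    simp [windowVertex, hp, hq, hpq]

theorem conj_mul_mul_inv {H : Type*} [Group H] (a b c : H) :
    a * b * c * (a * b)⁻¹ = a * (b * c * b⁻¹) * a⁻¹ := by
  simp only [mul_inv_rev, mul_assoc]

theorem conj_zpow_of_inStar {x : V} (h : InStar G v x) (k : ℤ) :
    of G v ^ k * of G x * (of G v ^ k)⁻¹ = of G x := by
  have : Commute (of G v) (of G x) := by
    obtain rfl | h := h
    · exact .refl _
    · exact commute_of_adj h
  rw [(this.zpow_left k).eq, mul_inv_cancel_right]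

variable (G v)

open Classical in
/-- The homomorphism `A(multiDouble G v n) → A(G)` onto the elements whose exponent sum in `v` is
divisible by `n`. -/
noncomputable def foldHom (n : ℕ) : RAAG (multiDouble G v n) →* RAAG G :=
  lift (fun p => if p.1.1 = v then of G v ^ n else
    of G v ^ p.1.2 * of G p.1.1 * (of G v ^ p.1.2)⁻¹) fun p q h => by
  have key : ∀ y (i : ℤ), G.Adj v y →
      Commute (of G v ^ n) (of G v ^ i * of G y * (of G v ^ i)⁻¹) := fun y i hy => by
    rw [conj_zpow_of_inStar (.inr hy)]
    exact (commute_of_adj hy).pow_left n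
  have key' : ∀ x y (i : ℤ), G.Adj v x → G.Adj x y →
      Commute (of G x) (of G v ^ i * of G y * (of G v ^ i)⁻¹) := fun x y i hx hxy => by
    have h := (commute_of_adj hx.symm).zpow_right i
    exact (h.mul_right (commute_of_adj hxy)).mul_right h.inv_right
  obtain ⟨⟨x, i⟩, hx⟩ := p
  obtain ⟨⟨y, j⟩, hy⟩ := q
  have hxy : G.Adj x y := h.1
  dsimp only
  split_ifs with hxv hyv hyv
  · exact .refl _
  · exact key _ _ (hxv ▸ hxy)
  · exact (key _ _ (hyv ▸ hxy.symm)).symm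
  · obtain hx | hy | ⟨hij, -, -⟩ := cover_adj_cases h
    · rw [conj_zpow_of_inStar (x := x) (.inr hx)]
      exact key' _ _ _ hx hxy
    · rw [conj_zpow_of_inStar (x := y) (.inr hy)]
      exact (key' _ _ _ hy hxy.symm).symm
    · obtain rfl : i = j := hij
      exact (Commute.conj_iff _).2 (commute_of_adj hxy)

variable {G v}

theorem foldHom_of_eq {n : ℕ} {p : window G v n} (h : p.1.1 = v) :
    foldHom G v n (of _ p) = of G v ^ n := by
  simp [foldHom, h]

theorem foldHom_of_ne {n : ℕ} {p : window G v n} (h : p.1.1 ≠ v) :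
    foldHom G v n (of _ p) = of G v ^ p.1.2 * of G p.1.1 * (of G v ^ p.1.2)⁻¹ := by
  simp [foldHom, h]

theorem foldHom_windowVertex {n : ℕ} (hn : 0 < n) {x : V} (hx : x ≠ v) {i : ℤ} (h0 : 0 ≤ i)
    (h1 : i < n) : foldHom G v n (of _ (windowVertex v hn (x, i))) =
      of G v ^ i * of G x * (of G v ^ i)⁻¹ := by
  rw [foldHom_of_ne (p := windowVertex v hn (x, i)) hx]
  by_cases h : InStar G v x
  · simp only [windowVertex, conj_zpow_of_inStar h]
  · simp only [windowVertex, if_neg h, Int.emod_eq_of_lt h0 h1]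

variable (G v) in
/-- The inclusion of the extension by the translation by `n` into the extension by the translation
by one. -/
noncomputable def CoverExt.inclusion (n : ℕ) : CoverExt G v n →* CoverExt G v 1 :=
  SemidirectProduct.map (MonoidHom.id _) (powMonoidHom n) fun k => by
    refine MonoidHom.ext fun g => ?_
    change shiftAut G v n k g = shiftAut G v 1 (k ^ n) g
    rw [shiftAut_apply, shiftAut_apply, toAdd_pow, one_mul, nsmul_eq_mul]

theorem CoverExt.inclusion_inl (n : ℕ) (g : RAAG (cover G v)) :
    CoverExt.inclusion G v n (.inl g) = .inl g :=
  SemidirectProduct.map_inl _ _ _ _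

theorem CoverExt.inclusion_inr (n : ℕ) (k : Multiplicative ℤ) :
    CoverExt.inclusion G v n (.inr k) = .inr (k ^ n) :=
  SemidirectProduct.map_inr _ _ _ _

theorem CoverExt.inclusion_injective {n : ℕ} (hn : 0 < n) :
    Function.Injective (CoverExt.inclusion G v n) := by
  intro p q h
  refine SemidirectProduct.ext ?_ (pow_left_injective hn.ne' ?_)
  · have := congrArg SemidirectProduct.left h
    rwa [CoverExt.inclusion, SemidirectProduct.map_left, SemidirectProduct.map_left] at this
  · have := congrArg SemidirectProduct.right h
    rwa [CoverExt.inclusion, SemidirectProduct.map_right, SemidirectProduct.map_right] at this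

/-- Composed with `toCoverExt`, the map factors through `CoverExt G v n` as `β` followed by the
inclusion: vⁿ is the translation by n, and vⁱxv⁻ⁱ is the vertex (x, i). Folding the cover onto the
window gives a left inverse `γ` of `β`. -/
theorem foldHom_injective {n : ℕ} (hn : 0 < n) : Function.Injective (foldHom G v n) := by
  classical
  have hn' : (0 : ℤ) < n := by exact_mod_cast hn
  let c : RAAG (multiDouble G v n) := of _ (windowVertex v hn (v, 0))
  let γ : CoverExt G v n →* RAAG (multiDouble G v n) := CoverExt.lift n hn' c
    (fun p => of _ (windowVertex v hn p))
    (fun x i hx => by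
      obtain rfl | hx := hx
      · have : windowVertex (G := G) x hn (x, 0) = windowVertex x hn (x, i) := by
          simp [windowVertex, InStar]
        rw [← this]
      · exact commute_of_adj (windowVertex_adj hn ⟨hx, .inr (.inr hx)⟩))
    (fun p q h => commute_of_adj (windowVertex_adj hn h))
    (fun x i => by simp [windowVertex])
  let f : window G v n → CoverExt G v n := fun p =>
    if p.1.1 = v then .inr (.ofAdd 1) else .inl (of _ p.1)
  have hf : ∀ p, CoverExt.inclusion G v n (f p) = toCoverExt G v (foldHom G v n (of _ p)) := by
    rintro p
    by_cases hp : p.1.1 = v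
    · rw [foldHom_of_eq hp, map_pow, toCoverExt_of_self]
      simp only [f, if_pos hp, CoverExt.inclusion_inr, ← map_pow]
    · rw [foldHom_of_ne hp, map_mul, map_mul, map_inv, map_zpow, toCoverExt_of_self,
        toCoverExt_of_ne hp]
      simp only [f, if_neg hp, CoverExt.inclusion_inl, ← map_zpow, inr_mul_inl_of_mul_inv]
      obtain ⟨⟨x, i⟩, h0, h1, h2⟩ := p
      -- A star vertex of the window has index 0, where `toCoverExt` puts it, and translations do
      -- not move it.
      by_cases hx : InStar G v x
      · obtain rfl := h2 hx
        simp [shift_of_inStar hx]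
      · simp [shift_of_not_inStar hx]
  let β : RAAG (multiDouble G v n) →* CoverExt G v n := lift f fun p q h => by
    have := (commute_of_adj h).map ((toCoverExt G v).comp (foldHom G v n))
    rw [MonoidHom.comp_apply, MonoidHom.comp_apply, ← hf, ← hf] at this
    exact CoverExt.inclusion_injective hn (by simpa only [map_mul] using this.eq)
  have hβof : ∀ p, β (of _ p) = f p := lift_of _ _
  have hβ : (CoverExt.inclusion G v n).comp β = (toCoverExt G v).comp (foldHom G v n) := hom_ext fun p => by
    rw [MonoidHom.comp_apply, hβof, hf, MonoidHom.comp_apply]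
  have hγ : γ.comp β = MonoidHom.id _ := hom_ext fun p => by
    rw [MonoidHom.comp_apply, hβof, MonoidHom.id_apply]
    by_cases hp : p.1.1 = v
    · simp only [f, if_pos hp, γ, CoverExt.lift_inr, toAdd_ofAdd, zpow_one, c]
      obtain ⟨⟨x, i⟩, h⟩ := p
      obtain rfl : x = v := hp
      obtain rfl : i = 0 := h.2.2 (.inl rfl)
      exact congrArg _ (windowVertex_val hn ⟨(x, 0), h⟩)
    · simp only [f, if_neg hp, γ, CoverExt.lift_inl_of, windowVertex_val,
        Int.ediv_eq_zero_of_lt p.2.1 p.2.2.1, zpow_zero, one_mul, inv_one, mul_one]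
  have hβinj : Function.Injective β :=
    Function.LeftInverse.injective (g := γ) fun x => DFunLike.congr_fun hγ x
  have : Function.Injective ((toCoverExt G v).comp (foldHom G v n)) := by
    rw [← hβ]
    exact (CoverExt.inclusion_injective hn).comp hβinj
  exact Function.Injective.of_comp (f := toCoverExt G v) this

/-! ### Removing a letter from conjugating words -/

open Classical in
/-- Conjugates of vertices, up to powers and a common conjugation, come from the multiple double,
with conjugating words that avoid `v`. -/
theorem exists_word_of_foldHom {n : ℕ} (hn : 0 < n) (x : V) (l : List (V × Bool)) (i : ℤ)
    (h0 : l.length ≤ i) (h1 : i + l.length < n) :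
    ∃ (l' : List (window G v n × Bool)) (x' : window G v n) (e : ℕ), e ≠ 0 ∧
      l'.length ≤ (l.filter (fun p => p.1 ≠ v)).length ∧
      foldHom G v n (word _ l' * of _ x' * (word _ l')⁻¹) =
        of G v ^ i * (word G l * of G x * (word G l)⁻¹) ^ e * (of G v ^ i)⁻¹ := by
  induction l generalizing i with
  | nil =>
    -- The generator over v maps to vⁿ, so the conjugate of v needs the power n; any other vertex
    -- needs none.
    refine ⟨[], windowVertex v hn (x, i), if x = v then n else 1, ?_, le_rfl, ?_⟩
    · split_ifs <;> omega
    · simp only [word, List.map_nil, List.prod_nil, one_mul, inv_one, mul_one]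
      by_cases hx : x = v
      · rw [foldHom_of_eq (p := windowVertex v hn (x, i)) hx, if_pos hx, hx,
          ((Commute.refl (of G v)).zpow_left i |>.pow_right n).eq, mul_inv_cancel_right]
      · rw [foldHom_windowVertex hn hx (by simpa using h0) (by simpa using h1), if_neg hx, pow_one]
  | cons s l ih =>
    obtain ⟨y, b⟩ := s
    simp only [List.length_cons, Nat.cast_add, Nat.cast_one] at h0 h1
    by_cases hy : y = v
    · subst hy
      -- A letter v or v⁻¹ only moves the index by one; the word shortens by one, so the bounds
      -- survive.
      obtain ⟨l', x', e, he, hl, h⟩ := ih (i + cond b 1 (-1)) (by cases b <;> simp <;> omega)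
        (by cases b <;> simp <;> omega)
      refine ⟨l', x', e, he, by simpa using hl, h.trans ?_⟩
      have hs : cond b (of G y) (of G y)⁻¹ = of G y ^ (cond b 1 (-1) : ℤ) := by cases b <;> simp
      rw [word_cons, hs, zpow_add, conj_mul_mul_inv _ (word G l) (of G x)]
      generalize word G l * of G x * (word G l)⁻¹ = g
      rw [conj_pow]
      simp only [mul_inv_rev, mul_assoc]
    · obtain ⟨l', x', e, he, hl, h⟩ := ih i (by omega) (by omega)
      refine ⟨(windowVertex v hn (y, i), b) :: l', x', e, he, by simpa [hy] using hl, ?_⟩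
      have hs : foldHom G v n (cond b (of _ (windowVertex v hn (y, i)))
          (of _ (windowVertex v hn (y, i)))⁻¹) =
          of G v ^ i * cond b (of G y) (of G y)⁻¹ * (of G v ^ i)⁻¹ := by
        have := foldHom_windowVertex (G := G) hn hy (i := i) (by omega) (by omega)
        cases b
        · simp only [cond_false, map_inv, this]
          group
        · exact this
      rw [word_cons, word_cons]
      calc _ = foldHom G v n (cond b (of _ (windowVertex v hn (y, i)))
              (of _ (windowVertex v hn (y, i)))⁻¹) *
            foldHom G v n (word _ l' * of _ x' * (word _ l')⁻¹) *
            (foldHom G v n (cond b (of _ (windowVertex v hn (y, i)))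
              (of _ (windowVertex v hn (y, i)))⁻¹))⁻¹ := by
            simp only [map_mul, map_inv, mul_assoc, mul_inv_rev]
        _ = _ := by
            rw [h, hs]
            generalize cond b (of G y) (of G y)⁻¹ = s
            rw [conj_mul_mul_inv s (word G l)]
            generalize word G l * of G x * (word G l)⁻¹ = g
            rw [conj_pow]
            simp only [mul_inv_rev, inv_inv, mul_assoc, inv_mul_cancel_left]

end RAAG

/-! ### Powers of conjugates and the induction -/

namespace RAAG

universe u

variable {V : Type u} {G : SimpleGraph V}

theorem commute_of_conj_pow {x : V} {g h : RAAG G} {n : ℕ} (hn : n ≠ 0)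
    (H : Commute ((g * of G x * g⁻¹) ^ n) h) : Commute (g * of G x * g⁻¹) h := by
  have hh : g * (g⁻¹ * h * g) * g⁻¹ = h := by group
  rw [conj_pow, ← hh, Commute.conj_iff] at H
  rw [← hh, Commute.conj_iff]
  exact commute_of_of_pow hn H

theorem commute_of_conj_pow_pow {x y : V} {g h : RAAG G} {m n : ℕ} (hm : m ≠ 0) (hn : n ≠ 0)
    (H : Commute ((g * of G x * g⁻¹) ^ m) ((h * of G y * h⁻¹) ^ n)) :
    Commute (g * of G x * g⁻¹) (h * of G y * h⁻¹) :=
  (commute_of_conj_pow hn (commute_of_conj_pow hm H).symm).symm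

/-- Exponent sums force x = y and m = n; then g⁻¹h commutes with xᵐ, hence with x. -/
theorem eq_of_conj_pow_eq {x y : V} {g h : RAAG G} {m n : ℕ} (hm : m ≠ 0)
    (H : (g * of G x * g⁻¹) ^ m = (h * of G y * h⁻¹) ^ n) :
    g * of G x * g⁻¹ = h * of G y * h⁻¹ := by
  rw [conj_pow, conj_pow] at H
  have hexp := congrArg (exponent G x) H
  simp only [map_mul, map_inv, mul_inv_cancel_comm, map_pow, exponent_of_self] at hexp
  by_cases hxy : y = x
  · subst hxy
    rw [exponent_of_self, ← ofAdd_nsmul, ← ofAdd_nsmul] at hexp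
    obtain rfl : m = n := by simpa using hexp
    have hc : Commute (of G y ^ m) (g⁻¹ * h) := by
      have : of G y ^ m = g⁻¹ * (h * of G y ^ m * h⁻¹) * g := by rw [← H]; group
      change _ * _ = _ * _
      conv_lhs => rw [this]
      group
    have := (commute_of_of_pow hm hc).eq
    calc g * of G y * g⁻¹ = g * (of G y * (g⁻¹ * h)) * h⁻¹ := by group
      _ = h * of G y * h⁻¹ := by rw [this]; group
  · rw [exponent_of_ne hxy, one_pow, ← ofAdd_nsmul] at hexp
    exact absurd (by simpa using hexp) hm

open Classical in
/-- A finite family of conjugates of vertices, given by conjugating words, generates, after passing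
to suitable elements, the group of its commutation graph. -/
theorem exists_injective_of_words {W : Type*} [Fintype W] (Λ : SimpleGraph W) (N : ℕ) :
    ∀ {V : Type u} (G : SimpleGraph V) (l : W → List (V × Bool)) (t : W → V),
      ∑ w, (l w).length = N →
      (Function.Injective fun w => word G (l w) * of G (t w) * (word G (l w))⁻¹) →
      (∀ w w', Λ.Adj w w' ↔ w ≠ w' ∧ Commute (word G (l w) * of G (t w) * (word G (l w))⁻¹)
        (word G (l w') * of G (t w') * (word G (l w'))⁻¹)) →
      ∃ φ : RAAG Λ →* RAAG G, Function.Injective φ := by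
  induction N using Nat.strong_induction_on with
  | _ N ih =>
  intro V G l t hN hinj hadj
  by_cases h0 : ∀ w, l w = []
  · simp only [h0, word, List.map_nil, List.prod_nil, one_mul, inv_one, mul_one] at hinj hadj
    have ht : Function.Injective t := fun w w' h => hinj (congrArg (of G) h)
    refine exists_injective_of_embedding ⟨⟨t, ht⟩, fun {w w'} => ?_⟩
    rw [hadj]
    exact ⟨fun h => ⟨fun e => G.irrefl (e ▸ h), commute_of_adj h⟩,
      fun h => adj_of_commute (ht.ne h.1) h.2⟩
  push Not at h0
  obtain ⟨w₀, hw₀⟩ := h0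
  obtain ⟨⟨v, b⟩, l₀, hl₀⟩ := List.exists_cons_of_ne_nil hw₀
  have hle : ∀ w, (l w).length ≤ N := fun w =>
    hN ▸ Finset.single_le_sum (f := fun w => (l w).length) (fun _ _ => Nat.zero_le _)
      (Finset.mem_univ w)
  -- Starting at index N, words of length at most N keep the index in [0, 2N], so 2N + 1 copies
  -- suffice.
  have hn : 0 < 2 * N + 1 := by omega
  choose l' t' e he hl' hfold using fun w => exists_word_of_foldHom (G := G) (v := v) hn (t w) (l w)
    N (by exact_mod_cast hle w) (by have := hle w; push_cast; omega)
  -- No word grows, and that of `w₀` loses its first letter v.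
  have hlt : ∑ w, (l' w).length < N := by
    refine lt_of_lt_of_eq (Finset.sum_lt_sum (fun w _ => (hl' w).trans (List.length_filter_le _ _))
      ⟨w₀, Finset.mem_univ _, (hl' w₀).trans_lt ?_⟩) hN
    rw [List.length_filter_lt_length_iff_exists]
    exact ⟨(v, b), by simp [hl₀], by simp⟩
  obtain ⟨ψ, hψ⟩ := ih _ hlt (multiDouble G v (2 * N + 1)) l' t' rfl
    (fun w w' h => by
      have := congrArg (foldHom G v (2 * N + 1)) h
      simp only [hfold] at this
      exact hinj (eq_of_conj_pow_eq (he w) (mul_left_cancel (mul_right_cancel this))))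
    (fun w w' => by
      rw [hadj, ← commute_map_iff (foldHom_injective hn), hfold, hfold, Commute.conj_iff]
      exact and_congr_right fun _ =>
        ⟨fun h => h.pow_pow _ _, commute_of_conj_pow_pow (he w) (he w')⟩)
  exact ⟨(foldHom G v (2 * N + 1)).comp ψ, (foldHom_injective hn).comp hψ⟩

end RAAG

theorem theorem1 {V W : Type*} [Finite V] [Finite W]
    (Γ : SimpleGraph V) (Λ : SimpleGraph W)
    (h : Λ.IsIndContained (extensionGraph Γ)) :
    ∃ φ : RAAG Λ →* RAAG Γ, Function.Injective φ := by
  have := Fintype.ofFinite W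
  obtain ⟨f⟩ := h
  have hf : ∀ w, ∃ (t : V) (l : List (V × Bool)),
      RAAG.word Γ l * RAAG.of Γ t * (RAAG.word Γ l)⁻¹ = (f w : RAAG Γ) := by
    intro w
    obtain ⟨t, ht⟩ := (f w).2
    obtain ⟨c, hc⟩ := isConj_iff.1 ht
    obtain ⟨l, rfl⟩ := RAAG.word_surjective c
    exact ⟨t, l, hc⟩
  choose t l hf using hf
  refine RAAG.exists_injective_of_words Λ _ Γ l t rfl ?_ ?_
  · intro w w' hw
    simp only [hf] at hw
    exact f.injective (Subtype.ext hw)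
  · intro w w'
    rw [hf, hf, ← f.map_rel_iff]
    exact and_congr_left fun _ => f.injective.ne_iff
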